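/- Let $\Lambda=\mathbb Z+i\mathbb Z$, $\Lambda_+=\{z\in\Lambda:\Re z\ge 0\}$ and $\alpha_\pm=\frac{1\pm i}{2}$. A function $f:\Lambda\to\mathbb C$ is discrete analytic if $$\frac{f(z+1+i)-f(z)}{1+i}=\frac{f(z+1)-f(z+i)}{1-i},\qquad z\in\Lambda .$$ The discrete integral of $f$ over a path $(z_0,\dots,z_n)$ in $\Lambda$ ($|z_k-z_{k-1}|=1$) is $\sum_{k=1}^n\frac{f(z_{k-1})+f(z_k)}2(z_k-z_{k-1})$; for discrete analytic $f$ it depends only on the end points. Put $(Zf)(z)=\frac{f(0)-f(z)}2+\int_0^z f\,\delta z$ and $z^{(n)}=(Z^n1)(z)$, $n=0,1,2,\dots$. A discrete analytic polynomial is a discrete analytic function on $\Lambda$ that is given by a complex polynomial in $z$ and its conjugate $z^*$. The functions $z^{(n)}$ form a basis of the space of discrete analytic polynomials, which is a commutative ring under pointwise addition and the convolution product $$\Big(\sum_m a_mz^{(m)}\Big)\odot\Big(\sum_n b_nz^{(n)}\Big)=\sum_{m,n}a_mb_nz^{(m+n)} .$$ Let $\mathbf H_2(\Lambda_+)$ be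 the space of functions on $\Lambda_+$ of the form $\sum_{n\ge0}\hat f(n)z^{(n)}$ with $\sum_n|\hat f(n)|^2<\infty$. For $\lambda\in\Lambda_+$ let $$R_\lambda=\{z\in\Lambda_+:\Re z\le\Re\lambda,\ |\Im z|\le|\Im\lambda|,\ \Im z\,\Im\lambda\ge0\},$$ and let $\alpha_\mp$ stand for $\alpha_-$ if $\Im\lambda\ge0$ and for $\alpha_+$ if $\Im\lambda<0$. **Claim.** Let $\lambda\in\Lambda_+$. A discrete analytic polynomial $p$ vanishes on $R_\lambda$ if and only if $$p(z)=z^{(\Re\lambda+1)}\odot(z+\alpha_\mp)^{\odot|\Im\lambda|}\odot q(z)$$ for some discrete analytic polynomial $q$. Consequently, in the ring of discrete analytic polynomials equipped with $\odot$, the discrete analytic polynomials whose restriction to $\Lambda_+$ belongs to $\mathbf H_2(\Lambda_+)$ and vanishes on $R_\lambda$ form a principal ideal, generated by $z^{(\Re\lambda+1)}\odot(z+\alpha_\mp)^{\odot|\Im\lambda|}$. -/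

import Mathlib

open Complex

noncomputable section

namespace DiscreteAnalytic

/-- The lattice point `i`. -/
def iL : GaussianInt := ⟨0, 1⟩

/-- The constants `α₊ = (1 + i) / 2` and `α₋ = (1 - i) / 2`. -/
def alphaPlus : ℂ := (1 + I) / 2

def alphaMinus : ℂ := (1 - I) / 2

/-- Discrete analytic functions on the lattice `Λ = ℤ + iℤ` (J. Ferrand). -/
def IsDA (f : GaussianInt → ℂ) : Prop :=
  ∀ z : GaussianInt, (f (z + 1 + iL) - f z) / (1 + I) = (f (z + 1) - f (z + iL)) / (1 - I)

/-- `γ 0, …, γ n` is a path in `Λ` from `a` to `b`: consecutive points are at distance one. -/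
def IsPath (γ : ℕ → GaussianInt) (n : ℕ) (a b : GaussianInt) : Prop :=
  γ 0 = a ∧ γ n = b ∧ ∀ k < n, ‖(γ (k + 1) : ℂ) - (γ k : ℂ)‖ = 1

/-- The discrete integral of `f` over the path `γ 0, …, γ n`. -/
def pathIntegral (f : GaussianInt → ℂ) (γ : ℕ → GaussianInt) (n : ℕ) : ℂ :=
  ∑ k ∈ Finset.range n, (f (γ k) + f (γ (k + 1))) / 2 * ((γ (k + 1) : ℂ) - (γ k : ℂ))

/-- The path from `0` to `z` that first runs along the real axis and then vertically;
the subtraction of natural numbers is truncated on purpose. -/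
def cornerPath (z : GaussianInt) (k : ℕ) : GaussianInt :=
  ⟨z.re.sign * (min k z.re.natAbs : ℕ), z.im.sign * (k - z.re.natAbs : ℕ)⟩

/-- The discrete integral from `0` to `z`, taken along `cornerPath z`. For a discrete analytic
function every other path gives the same value, see `pathIntegral_eq_integral`. -/
def integral (f : GaussianInt → ℂ) (z : GaussianInt) : ℂ :=
  pathIntegral f (cornerPath z) (z.re.natAbs + z.im.natAbs)

/-- The operator `Z`. -/
def Zop (f : GaussianInt → ℂ) (z : GaussianInt) : ℂ := (f 0 - f z) / 2 + integral f z

/-- The function `z ↦ z^{(n)}`, that is `Zⁿ 1`. -/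
def zpow (n : ℕ) : GaussianInt → ℂ := Zop^[n] (fun _ => 1)

/-- `f` is (the restriction to `Λ` of) a complex polynomial in `z` and `z*`. -/
def IsPoly (f : GaussianInt → ℂ) : Prop :=
  ∃ P : MvPolynomial (Fin 2) ℂ,
    ∀ z : GaussianInt, f z = MvPolynomial.eval ![(z : ℂ), (starRingEnd ℂ) (z : ℂ)] P

/-- The linear space of discrete analytic polynomials. -/
def DAPoly : Submodule ℂ (GaussianInt → ℂ) where
  carrier := {f | IsDA f ∧ IsPoly f}
  add_mem' := by
    rintro f g ⟨hf, P, hP⟩ ⟨hg, Q, hQ⟩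
    refine ⟨fun z => ?_, P + Q, fun z => by simp [hP, hQ]⟩
    have h1 := hf z
    have h2 := hg z
    simp only [Pi.add_apply]
    linear_combination h1 + h2
  zero_mem' := ⟨fun z => by simp, 0, fun z => by simp⟩
  smul_mem' := by
    rintro c f ⟨hf, P, hP⟩
    refine ⟨fun z => ?_, MvPolynomial.C c * P, fun z => by simp [hP]⟩
    have h1 := hf z
    simp only [Pi.smul_apply, smul_eq_mul]
    linear_combination c * h1

/-! ### Path independence -/

theorem mk_add_one (x y : ℤ) : (⟨x, y⟩ : GaussianInt) + 1 = ⟨x + 1, y⟩ := by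
  ext <;> simp

theorem mk_add_iL (x y : ℤ) : (⟨x, y⟩ : GaussianInt) + iL = ⟨x, y + 1⟩ := by
  ext <;> simp [iL]

theorem one_add_I_ne : (1 + I : ℂ) ≠ 0 := by
  intro h
  have := congrArg Complex.re h
  simp at this

theorem one_sub_I_ne : (1 - I : ℂ) ≠ 0 := by
  intro h
  have := congrArg Complex.re h
  simp at this

theorem isDA_iff (f : GaussianInt → ℂ) :
    IsDA f ↔ ∀ x y : ℤ, f ⟨x + 1, y + 1⟩ - f ⟨x, y⟩ = I * (f ⟨x + 1, y⟩ - f ⟨x, y + 1⟩) := by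
  have key : ∀ a b : ℂ, a / (1 + I) = b / (1 - I) ↔ a = I * b := by
    intro a b
    rw [div_eq_div_iff one_add_I_ne one_sub_I_ne]
    have e : b * (1 + I) = I * b * (1 - I) := by linear_combination (b : ℂ) * I_mul_I
    rw [e]
    exact mul_left_inj' one_sub_I_ne
  constructor
  · intro h x y
    have := (key _ _).1 (h ⟨x, y⟩)
    simpa only [mk_add_one, mk_add_iL] using this
  · rintro h ⟨x, y⟩
    rw [key]
    simpa only [mk_add_one, mk_add_iL] using h x y

/-- The discrete integral from `0` to `x` of a function on `ℤ`. -/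
def intAux (φ : ℤ → ℂ) (x : ℤ) : ℂ :=
  ∑ k ∈ Finset.range x.natAbs,
    (φ (x.sign * (k : ℕ)) + φ (x.sign * ((k + 1 : ℕ) : ℤ))) / 2 * (x.sign : ℂ)

theorem intAux_succ (φ : ℤ → ℂ) (x : ℤ) :
    intAux φ (x + 1) = intAux φ x + (φ x + φ (x + 1)) / 2 := by
  have hpos : ∀ n : ℕ, intAux φ (n : ℤ) =
      ∑ k ∈ Finset.range n, (φ (k : ℕ) + φ ((k + 1 : ℕ) : ℤ)) / 2 := by
    intro n
    rcases n with _ | n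
    · simp [intAux]
    · have hs : ((n + 1 : ℕ) : ℤ).sign = 1 := Int.sign_eq_one_of_pos (by positivity)
      simp only [intAux, hs, Int.natAbs_natCast, one_mul, Int.cast_one, mul_one]
  have hneg : ∀ n : ℕ, intAux φ (-(n : ℤ)) =
      ∑ k ∈ Finset.range n, -((φ (-(k : ℕ)) + φ (-((k + 1 : ℕ) : ℤ))) / 2) := by
    intro n
    rcases n with _ | n
    · simp [intAux]
    · have hs : (-((n + 1 : ℕ) : ℤ)).sign = -1 := Int.sign_eq_neg_one_of_neg (by omega)
      simp only [intAux, hs, Int.natAbs_neg, Int.natAbs_natCast, neg_mul, one_mul, Int.cast_neg,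
        Int.cast_one, mul_neg, mul_one]
  obtain ⟨n, rfl | rfl⟩ := x.eq_nat_or_neg
  · rw [← Nat.cast_succ, hpos, hpos, Finset.sum_range_succ]
  · rcases n with _ | n
    · simp [intAux]
    · have e : -((n + 1 : ℕ) : ℤ) + 1 = -(n : ℤ) := by push_cast; ring
      rw [e, hneg, hneg, Finset.sum_range_succ]
      ring

theorem integral_eq (f : GaussianInt → ℂ) (x y : ℤ) :
    integral f ⟨x, y⟩ = intAux (fun s => f ⟨s, 0⟩) x + I * intAux (fun s => f ⟨x, s⟩) y := by
  unfold integral pathIntegral intAux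
  simp only
  rw [Finset.sum_range_add, Finset.mul_sum]
  congr 1
  · refine Finset.sum_congr rfl fun k hk => ?_
    have hk' : k < x.natAbs := Finset.mem_range.1 hk
    have e1 : cornerPath ⟨x, y⟩ k = ⟨x.sign * (k : ℕ), 0⟩ := by
      ext <;> simp [cornerPath, hk'.le]
    have e2 : cornerPath ⟨x, y⟩ (k + 1) = ⟨x.sign * ((k + 1 : ℕ) : ℤ), 0⟩ := by
      have h1 : min (k + 1) x.natAbs = k + 1 := min_eq_left hk'
      have h2 : k + 1 - x.natAbs = 0 := by omega
      ext
      · simp only [cornerPath, h1]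
      · simp only [cornerPath, h2, Nat.cast_zero, mul_zero]
    rw [e1, e2, GaussianInt.toComplex_def', GaussianInt.toComplex_def']
    push_cast
    ring
  · refine Finset.sum_congr rfl fun k _ => ?_
    have e : ∀ k : ℕ, cornerPath ⟨x, y⟩ (x.natAbs + k) = ⟨x, y.sign * (k : ℕ)⟩ := by
      intro k
      have h1 : min (x.natAbs + k) x.natAbs = x.natAbs := min_eq_right (by omega)
      have h2 : x.natAbs + k - x.natAbs = k := by omega
      ext
      · simp only [cornerPath, h1, Int.sign_mul_natAbs]
      · simp only [cornerPath, h2]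
    rw [add_assoc, e, e, GaussianInt.toComplex_def', GaussianInt.toComplex_def']
    push_cast
    ring

theorem eq_of_step {D : ℤ → ℂ} (h : ∀ y, D (y + 1) = D y) (y : ℤ) : D y = D 0 := by
  induction y with
  | zero => rfl
  | succ n ih => rw [h, ih]
  | pred n ih =>
    rw [← ih, ← h (-(n : ℤ) - 1)]
    congr 1
    ring

theorem integral_zero (f : GaussianInt → ℂ) : integral f 0 = 0 := by
  simp [integral, pathIntegral]

theorem integral_step_im (f : GaussianInt → ℂ) (x y : ℤ) :
    integral f ⟨x, y + 1⟩ = integral f ⟨x, y⟩ + I * ((f ⟨x, y⟩ + f ⟨x, y + 1⟩) / 2) := by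
  rw [integral_eq, integral_eq, intAux_succ]
  ring

theorem integral_step_re {f : GaussianInt → ℂ} (hf : IsDA f) (x y : ℤ) :
    integral f ⟨x + 1, y⟩ = integral f ⟨x, y⟩ + (f ⟨x, y⟩ + f ⟨x + 1, y⟩) / 2 := by
  rw [isDA_iff] at hf
  have h := eq_of_step (D := fun y => integral f ⟨x + 1, y⟩ - integral f ⟨x, y⟩
    - (f ⟨x, y⟩ + f ⟨x + 1, y⟩) / 2) (fun y => by
      simp only [integral_step_im]
      have := hf x y
      linear_combination (-(1 - I) / 2 : ℂ) * this +
        ((f ⟨x + 1, y⟩ - f ⟨x, y + 1⟩) / 2) * I_mul_I) y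
  have h0 : integral f ⟨x + 1, 0⟩ = integral f ⟨x, 0⟩ + (f ⟨x, 0⟩ + f ⟨x + 1, 0⟩) / 2 := by
    simp only [integral_eq, intAux_succ]
    simp [intAux]
  simp only [h0] at h
  linear_combination h

/-- The discrete integral of a discrete analytic function does not depend on the path. -/
theorem pathIntegral_eq_integral {f : GaussianInt → ℂ} (hf : IsDA f) {γ : ℕ → GaussianInt}
    {n : ℕ} {z : GaussianInt} (h : IsPath γ n 0 z) : pathIntegral f γ n = integral f z := by
  obtain ⟨h0, hn, hs⟩ := h
  have edge : ∀ a b : GaussianInt, ‖(b : ℂ) - (a : ℂ)‖ = 1 →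
      (f a + f b) / 2 * ((b : ℂ) - (a : ℂ)) = integral f b - integral f a := by
    rintro ⟨x, y⟩ ⟨x', y'⟩ hab
    have h2 : (x' - x) ^ 2 + (y' - y) ^ 2 = 1 := by
      have h3 : Complex.normSq ((⟨x', y'⟩ : GaussianInt) - (⟨x, y⟩ : GaussianInt) : ℂ) = 1 := by
        rw [Complex.normSq_eq_norm_sq, hab]; norm_num
      rw [Complex.normSq_apply] at h3
      simp only [Complex.sub_re, Complex.sub_im, GaussianInt.re_toComplex,
        GaussianInt.im_toComplex] at h3
      have : (((x' - x) ^ 2 + (y' - y) ^ 2 : ℤ) : ℝ) = 1 := by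
        push_cast
        linarith
      exact_mod_cast this
    have bx : x' - x ≤ 1 ∧ -1 ≤ x' - x := by constructor <;> nlinarith [sq_nonneg (y' - y)]
    have hx : x' - x = 0 ∨ x' - x = 1 ∨ x' - x = -1 := by omega
    rw [GaussianInt.toComplex_def', GaussianInt.toComplex_def']
    rcases hx with hx | hx | hx
    · obtain rfl : x' = x := by omega
      have hy : (y' - y - 1) * (y' - y + 1) = 0 := by
        rw [hx] at h2
        linear_combination h2
      rcases mul_eq_zero.1 hy with hy | hy
      · obtain rfl : y' = y + 1 := by omega
        rw [integral_step_im]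
        push_cast
        ring
      · obtain rfl : y = y' + 1 := by omega
        rw [integral_step_im]
        push_cast
        ring
    · have hy : y' - y = 0 := by
        rw [hx] at h2
        exact pow_eq_zero_iff (n := 2) (by norm_num) |>.1 (by linarith)
      obtain rfl : y' = y := by omega
      obtain rfl : x' = x + 1 := by omega
      rw [integral_step_re hf]
      push_cast
      ring
    · have hy : y' - y = 0 := by
        rw [hx] at h2
        exact pow_eq_zero_iff (n := 2) (by norm_num) |>.1 (by linarith)
      obtain rfl : y' = y := by omega
      obtain rfl : x = x' + 1 := by omega
      rw [integral_step_re hf]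
      push_cast
      ring
  have : pathIntegral f γ n = ∑ k ∈ Finset.range n, (integral f (γ (k + 1)) - integral f (γ k)) :=
    Finset.sum_congr rfl fun k hk => edge _ _ (hs k (Finset.mem_range.1 hk))
  rw [this, Finset.sum_range_sub (fun k => integral f (γ k)), h0, hn, integral_zero, sub_zero]

theorem isPath_cornerPath (z : GaussianInt) :
    IsPath (cornerPath z) (z.re.natAbs + z.im.natAbs) 0 z := by
  refine ⟨?_, ?_, fun k hk => ?_⟩
  · ext <;> simp [cornerPath]
  · have h1 : min (z.re.natAbs + z.im.natAbs) z.re.natAbs = z.re.natAbs :=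
      min_eq_right (by omega)
    have h2 : z.re.natAbs + z.im.natAbs - z.re.natAbs = z.im.natAbs := by omega
    ext
    · simp only [cornerPath, h1, Int.sign_mul_natAbs]
    · simp only [cornerPath, h2, Int.sign_mul_natAbs]
  · have hsign : ∀ a : ℤ, a.natAbs ≠ 0 → ‖((a.sign : ℤ) : ℂ)‖ = 1 := by
      intro a ha
      rcases lt_trichotomy a 0 with h | h | h
      · simp [Int.sign_eq_neg_one_of_neg h]
      · simp [h] at ha
      · simp [Int.sign_eq_one_of_pos h]
    by_cases hk' : k < z.re.natAbs
    · have h1 : min (k + 1) z.re.natAbs = k + 1 := min_eq_left hk'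
      have h2 : k + 1 - z.re.natAbs = 0 := by omega
      have h3 : k - z.re.natAbs = 0 := by omega
      have h4 : min k z.re.natAbs = k := min_eq_left hk'.le
      have := hsign z.re (by omega)
      rw [← this]
      simp only [cornerPath, h1, h2, h3, h4, GaussianInt.toComplex_def']
      congr 1
      push_cast
      ring
    · have h1 : min (k + 1) z.re.natAbs = z.re.natAbs := min_eq_right (by omega)
      have h4 : min k z.re.natAbs = z.re.natAbs := min_eq_right (by omega)
      have h2 : k + 1 - z.re.natAbs = (k - z.re.natAbs) + 1 := by omega
      have := hsign z.im (by omega)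
      have e : ‖((z.im.sign : ℤ) : ℂ) * I‖ = 1 := by rw [norm_mul, this]; simp
      rw [← e]
      simp only [cornerPath, h1, h2, h4, GaussianInt.toComplex_def']
      congr 1
      push_cast
      ring

/-! ### The functions `z^{(n)}` form a basis of the discrete analytic polynomials -/

theorem isDA_one : IsDA (fun _ => 1) := fun z => by simp

theorem Zop_zero (f : GaussianInt → ℂ) : Zop f 0 = 0 := by simp [Zop, integral_zero]

theorem Zop_step_re {f : GaussianInt → ℂ} (hf : IsDA f) (x y : ℤ) :
    Zop f ⟨x + 1, y⟩ - Zop f ⟨x, y⟩ = f ⟨x, y⟩ := by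
  simp only [Zop, integral_step_re hf]
  ring

theorem isDA_Zop {f : GaussianInt → ℂ} (hf : IsDA f) : IsDA (Zop f) := by
  rw [isDA_iff]
  intro x y
  simp only [Zop, integral_step_im, integral_step_re hf]
  linear_combination ((f ⟨x, y⟩ + f ⟨x, y + 1⟩) / 2) * I_mul_I

theorem const_of_step_re {h : GaussianInt → ℂ} (hh : IsDA h)
    (hs : ∀ x y : ℤ, h ⟨x + 1, y⟩ = h ⟨x, y⟩) (z : GaussianInt) : h z = h 0 := by
  obtain ⟨x, y⟩ := z
  rw [isDA_iff] at hh
  have hy : ∀ y, h ⟨0, y + 1⟩ = h ⟨0, y⟩ := by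
    intro y
    have h1 := hh 0 y
    rw [hs, hs] at h1
    have h2 : (1 + I) * (h ⟨0, y + 1⟩ - h ⟨0, y⟩) = 0 := by linear_combination h1
    rcases mul_eq_zero.1 h2 with h3 | h3
    · exact absurd h3 one_add_I_ne
    · exact sub_eq_zero.1 h3
  rw [eq_of_step (D := fun x => h ⟨x, y⟩) (fun x => hs x y) x,
    eq_of_step (D := fun y => h ⟨0, y⟩) hy y]
  rfl

theorem isDA_zpow (n : ℕ) : IsDA (zpow n) := by
  induction n with
  | zero => exact isDA_one
  | succ n ih =>
    rw [zpow, Function.iterate_succ_apply']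
    exact isDA_Zop ih

theorem zpow_succ (n : ℕ) : zpow (n + 1) = Zop (zpow n) := by
  rw [zpow, Function.iterate_succ_apply']
  rfl

open PowerSeries in
/-- The generating function `(1 + t)^x ((1 + α₊ t) / (1 + α₋ t))^y` of the `z^{(n)}`. -/
def genSeries (x y : ℤ) : PowerSeries ℂ :=
  binomialSeries ℂ x * (rescale alphaPlus (binomialSeries ℂ y) *
    rescale alphaMinus (binomialSeries ℂ (-y)))

open PowerSeries in
theorem binomialSeries_one' : binomialSeries ℂ (1 : ℤ) = 1 + X := by
  simpa using binomialSeries_nat (R := ℤ) (A := ℂ) 1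

open PowerSeries in
theorem genSeries_step_re (x y : ℤ) : genSeries (x + 1) y = (1 + X) * genSeries x y := by
  simp only [genSeries, binomialSeries_add, binomialSeries_one']
  ring

open PowerSeries in
theorem genSeries_step_im (x y : ℤ) : (1 + C alphaMinus * X) * genSeries x (y + 1) =
    (1 + C alphaPlus * X) * genSeries x y := by
  have h : binomialSeries ℂ (-y) = binomialSeries ℂ (-(y + 1)) * (1 + X) := by
    rw [← binomialSeries_one', ← binomialSeries_add]
    congr 1
    ring
  simp only [genSeries, h, binomialSeries_add, binomialSeries_one', map_mul, map_add, map_one,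
    rescale_X]
  ring

open PowerSeries in
theorem genSeries_da (x y : ℤ) : genSeries (x + 1) (y + 1) - genSeries x y =
    C I * (genSeries (x + 1) y - genSeries x (y + 1)) := by
  have hne : (1 + C alphaMinus * X : PowerSeries ℂ) ≠ 0 := by
    intro h
    have := congrArg (constantCoeff (R := ℂ)) h
    simp at this
  apply mul_left_cancel₀ hne
  have h1 := genSeries_step_im x y
  have h2 : C alphaPlus = (C I * C alphaMinus : PowerSeries ℂ) := by
    rw [← map_mul]
    congr 1
    simp only [alphaPlus, alphaMinus]
    linear_combination (1 / 2 : ℂ) * I_mul_I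
  have h4 : (C alphaMinus : PowerSeries ℂ) * (1 + C I) = 1 := by
    rw [← map_one (C (R := ℂ)), ← map_add, ← map_mul]
    congr 1
    simp only [alphaMinus]
    linear_combination (-1 / 2 : ℂ) * I_mul_I
  rw [genSeries_step_re, genSeries_step_re]
  rw [h2] at h1
  linear_combination (1 + X + C I) * h1 + genSeries x y * X * (C I - 1) * h4

open PowerSeries in
theorem coeff_genSeries (n : ℕ) (x y : ℤ) : coeff n (genSeries x y) = zpow n ⟨x, y⟩ := by
  have hda : ∀ n, IsDA (fun z => coeff n (genSeries z.re z.im)) := by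
    intro n
    rw [isDA_iff]
    intro x y
    have := congrArg (coeff n) (genSeries_da x y)
    simpa using this
  suffices h : ∀ n, (fun z : GaussianInt => coeff n (genSeries z.re z.im)) = zpow n from
    congrFun (h n) ⟨x, y⟩
  intro n
  induction n with
  | zero =>
    funext z
    have hr : ∀ (a : ℂ) (φ : PowerSeries ℂ),
        constantCoeff (rescale a φ) = constantCoeff φ := by
      intro a φ
      rw [← coeff_zero_eq_constantCoeff_apply, coeff_rescale, pow_zero, one_mul,
        coeff_zero_eq_constantCoeff_apply]
    simp [genSeries, zpow, hr]
  | succ n ih =>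
    rw [zpow_succ]
    have hz := isDA_zpow n
    funext z
    rw [← sub_eq_zero]
    refine (const_of_step_re (h := fun z => coeff (n + 1) (genSeries z.re z.im) - Zop (zpow n) z)
      ?_ ?_ z).trans ?_
    · have h1 := (isDA_iff _).1 (hda (n + 1))
      have h2 := (isDA_iff _).1 (isDA_Zop hz)
      rw [isDA_iff]
      intro x y
      linear_combination h1 x y - h2 x y
    · intro x y
      have h1 := Zop_step_re hz x y
      have h2 := congrFun ih ⟨x, y⟩
      simp only at h2
      simp only [genSeries_step_re, add_mul, one_mul, map_add, coeff_succ_X_mul]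
      linear_combination h2 - h1
    · simp [Zop_zero, genSeries]

theorem IsPoly.add {f g : GaussianInt → ℂ} (hf : IsPoly f) (hg : IsPoly g) :
    IsPoly (fun z => f z + g z) := by
  obtain ⟨P, hP⟩ := hf
  obtain ⟨Q, hQ⟩ := hg
  exact ⟨P + Q, fun z => by simp [hP, hQ]⟩

theorem IsPoly.mul {f g : GaussianInt → ℂ} (hf : IsPoly f) (hg : IsPoly g) :
    IsPoly (fun z => f z * g z) := by
  obtain ⟨P, hP⟩ := hf
  obtain ⟨Q, hQ⟩ := hg
  exact ⟨P * Q, fun z => by simp [hP, hQ]⟩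

theorem IsPoly.const (c : ℂ) : IsPoly (fun _ => c) := ⟨MvPolynomial.C c, fun z => by simp⟩

theorem IsPoly.sum {ι : Type*} (s : Finset ι) {f : ι → GaussianInt → ℂ}
    (hf : ∀ i ∈ s, IsPoly (f i)) : IsPoly (fun z => ∑ i ∈ s, f i z) := by
  classical
  induction s using Finset.induction_on with
  | empty => simpa using IsPoly.const 0
  | insert a s ha ih =>
    simp only [Finset.sum_insert ha]
    exact (hf a (Finset.mem_insert_self a s)).add
      (ih fun i hi => hf i (Finset.mem_insert_of_mem hi))

theorem isPoly_self : IsPoly (fun z => (z : ℂ)) := ⟨MvPolynomial.X 0, fun z => by simp⟩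

theorem isPoly_re : IsPoly (fun z => (z.re : ℂ)) := by
  refine ⟨MvPolynomial.C (1 / 2) * (MvPolynomial.X 0 + MvPolynomial.X 1), fun z => ?_⟩
  simp [GaussianInt.toComplex_def]
  ring

theorem isPoly_im : IsPoly (fun z => (z.im : ℂ)) := by
  refine ⟨MvPolynomial.C (-I / 2) * (MvPolynomial.X 0 - MvPolynomial.X 1), fun z => ?_⟩
  simp [GaussianInt.toComplex_def]
  linear_combination ((z.im : ℂ)) * I_mul_I

theorem isPoly_choose {a : GaussianInt → ℤ} (ha : IsPoly (fun z => (a z : ℂ))) (n : ℕ) :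
    IsPoly (fun z => ((Ring.choose (a z) n : ℤ) : ℂ)) := by
  obtain ⟨P, hP⟩ := ha
  refine ⟨MvPolynomial.C (n.factorial : ℂ)⁻¹ * Polynomial.aeval P (descPochhammer ℤ n),
    fun z => ?_⟩
  have h := congrArg (fun k : ℤ => (k : ℂ)) (Ring.descPochhammer_eq_factorial_smul_choose (a z) n)
  simp only [nsmul_eq_mul, Int.cast_mul, Int.cast_natCast] at h
  have hn : (n.factorial : ℂ) ≠ 0 := by exact_mod_cast n.factorial_ne_zero
  rw [← Polynomial.aeval_eq_smeval] at h
  have h1 : (((Polynomial.aeval (a z)) (descPochhammer ℤ n) : ℤ) : ℂ) =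
      Polynomial.aeval ((a z : ℤ) : ℂ) (descPochhammer ℤ n) := by
    simpa using (Polynomial.aeval_algebraMap_apply ℂ (a z) (descPochhammer ℤ n)).symm
  have h2 : MvPolynomial.eval ![(z : ℂ), (starRingEnd ℂ) (z : ℂ)]
      (Polynomial.aeval P (descPochhammer ℤ n)) =
      Polynomial.aeval ((a z : ℤ) : ℂ) (descPochhammer ℤ n) := by
    have hPz : ((a z : ℤ) : ℂ) = _ := hP z
    rw [hPz]
    simp only [Polynomial.aeval_def, Polynomial.hom_eval₂]
    congr 1
    exact RingHom.ext_int _ _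
  rw [map_mul, MvPolynomial.eval_C, h2, ← h1, h, inv_mul_cancel_left₀ hn]

theorem isPoly_zpow (n : ℕ) : IsPoly (zpow n) := by
  have e : zpow n = fun z : GaussianInt => PowerSeries.coeff n (genSeries z.re z.im) := by
    funext z
    rw [coeff_genSeries]
  rw [e]
  simp only [genSeries, PowerSeries.coeff_mul, PowerSeries.coeff_rescale,
    PowerSeries.binomialSeries_coeff, zsmul_eq_mul, mul_one]
  have him : IsPoly (fun z => ((-z.im : ℤ) : ℂ)) := by
    simpa using (IsPoly.const (-1)).mul isPoly_im
  refine IsPoly.sum _ fun p _ => (isPoly_choose isPoly_re _).mul (IsPoly.sum _ fun q _ => ?_)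
  exact ((IsPoly.const _).mul (isPoly_choose isPoly_im _)).mul
    ((IsPoly.const _).mul (isPoly_choose him _))

/-- `z^{(n)}` as a discrete analytic polynomial. -/
def zpowDA (n : ℕ) : DAPoly := ⟨zpow n, isDA_zpow n, isPoly_zpow n⟩

theorem fwdDiff_zpow_zero : fwdDiff 1 (zpow 0) = 0 := by
  funext z
  simp [fwdDiff, zpow]

theorem fwdDiff_zpow_succ (n : ℕ) : fwdDiff 1 (zpow (n + 1)) = zpow n := by
  funext ⟨x, y⟩
  rw [zpow_succ, fwdDiff, mk_add_one, Zop_step_re (isDA_zpow n)]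

theorem zpow_apply_zero (n : ℕ) : zpow n 0 = if n = 0 then 1 else 0 := by
  rcases n with _ | n
  · simp [zpow]
  · simp [zpow_succ, Zop_zero]

theorem fwdDiff_iter_zero' (k : ℕ) : (fwdDiff (1 : GaussianInt))^[k] (0 : GaussianInt → ℂ) = 0 := by
  induction k with
  | zero => rfl
  | succ k ih =>
    rw [Function.iterate_succ_apply', ih]
    funext z
    simp [fwdDiff]

theorem fwdDiff_iter_zpow (k n : ℕ) :
    (fwdDiff 1)^[k] (zpow n) 0 = if n = k then 1 else 0 := by
  induction k generalizing n with
  | zero => simpa using zpow_apply_zero n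
  | succ k ih =>
    rw [Function.iterate_succ_apply]
    rcases n with _ | n
    · rw [fwdDiff_zpow_zero, fwdDiff_iter_zero']
      simp
    · rw [fwdDiff_zpow_succ, ih]
      simp

theorem linearIndependent_zpow : LinearIndependent ℂ zpow := by
  rw [linearIndependent_iff']
  intro s g hg k hk
  have h := congrFun (congrArg (fwdDiff (1 : GaussianInt))^[k] hg) 0
  rw [fwdDiff_iter_zero', fwdDiff_iter_finsetSum, Finset.sum_apply] at h
  simp only [fwdDiff_iter_const_smul, Pi.smul_apply, fwdDiff_iter_zpow, smul_eq_mul, mul_ite,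
    mul_one, mul_zero, Finset.sum_ite_eq', hk, if_true, Pi.zero_apply] at h
  exact h

theorem exists_fwdDiff_iter_eq_zero {f : GaussianInt → ℂ} (hf : IsPoly f) :
    ∃ N, (fwdDiff 1)^[N] f = 0 := by
  obtain ⟨P, hP⟩ := hf
  let Q : GaussianInt → Polynomial ℂ := fun z => MvPolynomial.aeval
    ![Polynomial.X + Polynomial.C (z : ℂ),
      Polynomial.X + Polynomial.C ((starRingEnd ℂ) (z : ℂ))] P
  have hdeg : ∀ z, (Q z).natDegree ≤ P.totalDegree := by
    intro z
    simp only [Q]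
    rw [MvPolynomial.aeval_def, MvPolynomial.eval₂_eq]
    refine Polynomial.natDegree_sum_le_of_forall_le _ _ fun d hd => ?_
    refine (Polynomial.natDegree_C_mul_le _ _).trans ?_
    refine (Polynomial.natDegree_prod_le _ _).trans ?_
    refine le_trans (Finset.sum_le_sum (g := fun i => d i) fun i _ => ?_)
      (MvPolynomial.le_totalDegree hd)
    refine Polynomial.natDegree_pow_le.trans ?_
    have : (![Polynomial.X + Polynomial.C (z : ℂ),
      Polynomial.X + Polynomial.C ((starRingEnd ℂ) (z : ℂ))] i).natDegree ≤ 1 := by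
      fin_cases i <;> simp
    simpa using Nat.mul_le_mul_left (d i) this
  have heval : ∀ (z : GaussianInt) (n : ℕ), (Q z).eval (n : ℂ) = f (z + n) := by
    intro z n
    rw [hP]
    simp only [Q]
    rw [MvPolynomial.aeval_def, ← Polynomial.coe_evalRingHom, MvPolynomial.hom_eval₂,
      ← MvPolynomial.eval₂_id]
    congr 1
    · ext c
      simp
    · funext i
      fin_cases i <;> simp [add_comm]
  refine ⟨P.totalDegree + 1, funext fun z => ?_⟩
  have h := congrFun (Polynomial.fwdDiff_iter_eq_zero_of_degree_lt
    (Nat.lt_succ_of_le (hdeg z))) 0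
  rw [fwdDiff_iter_eq_sum_shift] at h ⊢
  simpa [heval] using h

theorem mem_span_zpow {f : GaussianInt → ℂ} (hf : IsDA f) (hp : IsPoly f) :
    f ∈ Submodule.span ℂ (Set.range zpow) := by
  obtain ⟨N, hN⟩ := exists_fwdDiff_iter_eq_zero hp
  have hle : Submodule.span ℂ (Set.range zpow) ≤ DAPoly := by
    rw [Submodule.span_le]
    rintro _ ⟨n, rfl⟩
    exact (zpowDA n).2
  clear hp
  induction N generalizing f with
  | zero =>
    rw [show f = 0 from hN]
    exact Submodule.zero_mem _
  | succ N ih =>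
    have hda : IsDA (fwdDiff 1 f) := by
      rw [isDA_iff] at hf ⊢
      intro x y
      have h1 := hf x y
      have h2 := hf (x + 1) y
      simp only [fwdDiff, mk_add_one]
      linear_combination h2 - h1
    have hg := ih hda hN
    have lift : ∀ g ∈ Submodule.span ℂ (Set.range zpow),
        ∃ G ∈ Submodule.span ℂ (Set.range zpow), fwdDiff 1 G = g := by
      intro g hg
      induction hg using Submodule.span_induction with
      | mem g hg =>
        obtain ⟨n, rfl⟩ := hg
        exact ⟨zpow (n + 1), Submodule.subset_span ⟨n + 1, rfl⟩, fwdDiff_zpow_succ n⟩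
      | zero => exact ⟨0, Submodule.zero_mem _, fwdDiff_iter_zero' 1⟩
      | add g₁ g₂ _ _ h₁ h₂ =>
        obtain ⟨G₁, m₁, rfl⟩ := h₁
        obtain ⟨G₂, m₂, rfl⟩ := h₂
        exact ⟨G₁ + G₂, Submodule.add_mem _ m₁ m₂, fwdDiff_add 1 G₁ G₂⟩
      | smul c g _ h =>
        obtain ⟨G, m, rfl⟩ := h
        exact ⟨c • G, Submodule.smul_mem _ c m, fwdDiff_const_smul 1 c G⟩
    obtain ⟨G, hG, hGf⟩ := lift _ hg
    have hGda := (hle hG).1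
    have hc : ∀ z, f z - G z = f 0 - G 0 := by
      refine const_of_step_re (h := fun z => f z - G z) ?_ ?_
      · rw [isDA_iff] at hf hGda ⊢
        intro x y
        linear_combination hf x y - hGda x y
      · intro x y
        have := congrFun hGf ⟨x, y⟩
        simp only [fwdDiff, mk_add_one] at this
        linear_combination -this
    have : f = G + (f 0 - G 0) • zpow 0 := by
      funext z
      have := hc z
      simp [zpow]
      linear_combination this
    rw [this]
    exact Submodule.add_mem _ hG (Submodule.smul_mem _ _ (Submodule.subset_span ⟨0, rfl⟩))

/-- The basis `z^{(0)}, z^{(1)}, …` of the space of discrete analytic polynomials. -/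
def zBasis : Module.Basis ℕ ℂ DAPoly :=
  Module.Basis.mk (v := zpowDA)
    (LinearIndependent.of_comp DAPoly.subtype linearIndependent_zpow)
    (by
      rintro ⟨f, hf⟩ -
      have h := mem_span_zpow hf.1 hf.2
      have e : Set.range zpow = DAPoly.subtype '' Set.range zpowDA := by
        rw [← Set.range_comp]
        rfl
      rw [e, Submodule.span_image] at h
      obtain ⟨g, hg, hgf⟩ := h
      have : g = ⟨f, hf⟩ := Subtype.ext hgf
      exact this ▸ hg)

/-! ### The convolution product -/

/-- The convolution product
`(∑ aₘ z^{(m)}) ⊙ (∑ bₙ z^{(n)}) = ∑ ∑ aₘ bₙ z^{(m+n)}` of discrete analytic polynomials. -/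
def conv (f g : DAPoly) : DAPoly :=
  (zBasis.repr f).sum fun m a => (zBasis.repr g).sum fun n b => (a * b) • zpowDA (m + n)

instance instMulDAPoly : Mul DAPoly := ⟨conv⟩

instance instOneDAPoly : One DAPoly := ⟨zpowDA 0⟩

/-- The linear isomorphism `z^{(n)} ↦ Xⁿ`. -/
def toPolynomial : DAPoly ≃ₗ[ℂ] Polynomial ℂ :=
  zBasis.equiv (Polynomial.basisMonomials ℂ) (Equiv.refl ℕ)

theorem toPolynomial_zpowDA (n : ℕ) : toPolynomial (zpowDA n) = Polynomial.X ^ n := by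
  have : zpowDA n = zBasis n := by simp [zBasis]
  rw [this, toPolynomial, Module.Basis.equiv_apply]
  simp [Polynomial.X_pow_eq_monomial]

theorem toPolynomial_mul (f g : DAPoly) :
    toPolynomial (f * g) = toPolynomial f * toPolynomial g := by
  have h : ∀ f : DAPoly, toPolynomial f =
      (zBasis.repr f).sum fun m a => a • (Polynomial.X ^ m : Polynomial ℂ) := by
    intro f
    conv_lhs => rw [← zBasis.linearCombination_repr f]
    rw [Finsupp.linearCombination_apply, map_finsuppSum]
    refine Finsupp.sum_congr fun m _ => ?_
    rw [map_smul, ← toPolynomial_zpowDA]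
    simp [zBasis]
  change toPolynomial (conv f g) = _
  rw [conv, h f, h g, map_finsuppSum, Finsupp.sum_mul]
  refine Finsupp.sum_congr fun m _ => ?_
  rw [map_finsuppSum, Finsupp.mul_sum]
  refine Finsupp.sum_congr fun n _ => ?_
  rw [map_smul, toPolynomial_zpowDA, smul_mul_smul_comm, pow_add]

theorem toPolynomial_one : toPolynomial 1 = 1 := toPolynomial_zpowDA 0

/-- The ring of discrete analytic polynomials: pointwise addition, the product `⊙`. -/
instance instCommRingDAPoly : CommRing DAPoly :=
  { (inferInstance : AddCommGroup DAPoly), instMulDAPoly, instOneDAPoly with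
    mul_assoc := fun a b c => toPolynomial.injective (by simp only [toPolynomial_mul, mul_assoc])
    mul_comm := fun a b => toPolynomial.injective (by simp only [toPolynomial_mul, mul_comm])
    one_mul := fun a => toPolynomial.injective (by
      simp only [toPolynomial_mul, toPolynomial_one, one_mul])
    mul_one := fun a => toPolynomial.injective (by
      simp only [toPolynomial_mul, toPolynomial_one, mul_one])
    zero_mul := fun a => toPolynomial.injective (by
      simp only [toPolynomial_mul, map_zero, zero_mul])
    mul_zero := fun a => toPolynomial.injective (by
      simp only [toPolynomial_mul, map_zero, mul_zero])
    left_distrib := fun a b c => toPolynomial.injective (by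
      simp only [toPolynomial_mul, map_add, mul_add])
    right_distrib := fun a b c => toPolynomial.injective (by
      simp only [toPolynomial_mul, map_add, add_mul]) }

/-- The discrete analytic polynomial `z + c`. -/
def linearDA (c : ℂ) : DAPoly :=
  ⟨fun z => (z : ℂ) + c, by
    rw [isDA_iff]
    intro x y
    simp only [GaussianInt.toComplex_def']
    push_cast
    linear_combination I_mul_I, isPoly_self.add (IsPoly.const c)⟩

/-! ### The interpolation problem -/

/-- The half-lattice `Λ₊`. -/
def halfLattice : Set GaussianInt := {z | 0 ≤ z.re}

/-- The rectangle `R_λ`. -/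
def rectangle (l : GaussianInt) : Set GaussianInt :=
  {z | z ∈ halfLattice ∧ z.re ≤ l.re ∧ |z.im| ≤ |l.im| ∧ 0 ≤ z.im * l.im}

/-- Membership in the Hardy space `H₂(Λ₊)`: on `Λ₊` the function is the sum of a series
`∑ a(n) z^{(n)}` with square summable coefficients (such a sum is automatically discrete analytic on `Λ₊`).
Only the values on `Λ₊` matter. -/
def MemHardy (f : GaussianInt → ℂ) : Prop :=
  ∃ a : ℕ → ℂ, Summable (fun n => ‖a n‖ ^ 2) ∧
    ∀ z ∈ halfLattice, HasSum (fun n => a n * zpow n z) (f z)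

/-- Solutions of the homogeneous interpolation problem: the functions in `H₂(Λ₊)` that vanish
on the rectangle `R_λ`. -/
def IsSolution (l : GaussianInt) (f : GaussianInt → ℂ) : Prop :=
  MemHardy f ∧ ∀ z ∈ rectangle l, f z = 0

/-- The constant `α_∓`: it is `α₋` if `Im λ ≥ 0` and `α₊` otherwise. -/
def alphaMP (l : GaussianInt) : ℂ := if 0 ≤ l.im then alphaMinus else alphaPlus

/-- The polynomial `z^{(Re λ + 1)} ⊙ (z + α_∓)^{⊙ |Im λ|}`, for `Re λ ≥ 0`. -/
def generator (l : GaussianInt) : DAPoly :=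
  zpowDA (l.re.toNat + 1) * linearDA (alphaMP l) ^ l.im.natAbs

end DiscreteAnalytic

end

/-!
By the definition of `Z` and path independence, `Zf` satisfies, for neighbours `z` and `z + d`,
`Zf(z + d) - Zf(z) = (f(z) - f(z + d)) / 2 + d (f(z) + f(z + d)) / 2`. Since `z ⊙ f = Zf`, this
says that `g = (z + (1 - d) / 2) ⊙ f` has the difference `g(z + d) - g(z) = d f(z)`. The constant
`(1 - d) / 2` is `0` for `d = 1` and `α_∓` for `d = ± i`.

Hence `g` vanishes on a segment of lattice points in the direction `d` iff it vanishes at its first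
point and `f` vanishes on the segment without its last point. Removing the points of the rectangle
in this way, column by column and then row by row, turns each of them into a linear factor. That a
polynomial which vanishes at `0` and `d` has the factor `z + (1 - d) / 2` follows by division with
remainder.
-/

namespace DiscreteAnalytic

theorem IsPath.update_succ {γ : ℕ → GaussianInt} {n : ℕ} {a b c : GaussianInt}
    (h : IsPath γ n a b) (hbc : ‖(c : ℂ) - (b : ℂ)‖ = 1) :
    IsPath (Function.update γ (n + 1) c) (n + 1) a c := by
  obtain ⟨hstart, hend, hstep⟩ := h
  refine ⟨by rw [Function.update_of_ne (by omega), hstart], Function.update_self .., ?_⟩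
  intro k hk
  rw [Function.update_of_ne (by omega : k ≠ n + 1)]
  rcases Nat.lt_succ_iff_lt_or_eq.1 hk with hlt | rfl
  · rw [Function.update_of_ne (by omega), hstep k hlt]
  · rw [Function.update_self, hend, hbc]

theorem pathIntegral_update_succ (f : GaussianInt → ℂ) (γ : ℕ → GaussianInt) (n : ℕ)
    (c : GaussianInt) :
    pathIntegral f (Function.update γ (n + 1) c) (n + 1) =
      pathIntegral f γ n + (f (γ n) + f c) / 2 * ((c : ℂ) - (γ n : ℂ)) := by
  rw [pathIntegral, Finset.sum_range_succ, Function.update_self,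
    Function.update_of_ne (by omega : n ≠ n + 1)]
  congr 1
  refine Finset.sum_congr rfl fun k hk => ?_
  have hk' : k < n := Finset.mem_range.1 hk
  rw [Function.update_of_ne (by omega), Function.update_of_ne (by omega)]

theorem integral_eq_add_of_norm_sub_eq_one {f : GaussianInt → ℂ} (hf : IsDA f)
    {z w : GaussianInt} (hzw : ‖(w : ℂ) - (z : ℂ)‖ = 1) :
    integral f w = integral f z + (f z + f w) / 2 * ((w : ℂ) - (z : ℂ)) := by
  have hpath := isPath_cornerPath z
  rw [← pathIntegral_eq_integral hf (hpath.update_succ hzw), pathIntegral_update_succ, hpath.2.1,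
    integral]

theorem pathIntegral_one (γ : ℕ → GaussianInt) (n : ℕ) :
    pathIntegral (fun _ => 1) γ n = (γ n : ℂ) - (γ 0 : ℂ) := by
  rw [← Finset.sum_range_sub (fun k => (γ k : ℂ)), pathIntegral]
  exact Finset.sum_congr rfl fun k _ => by ring

theorem zpow_one (z : GaussianInt) : zpow 1 z = z := by
  obtain ⟨hstart, hend, -⟩ := isPath_cornerPath z
  have hint : integral (fun _ => 1) z = z := by
    rw [integral, pathIntegral_one, hstart, hend, GaussianInt.toComplex_zero, sub_zero]
  change Zop (fun _ => 1) z = z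
  rw [Zop, hint, sub_self, zero_div, zero_add]

theorem Zop_add_of_norm_eq_one {f : GaussianInt → ℂ} (hf : IsDA f) {d : GaussianInt}
    (hd : ‖(d : ℂ)‖ = 1) (z : GaussianInt) :
    Zop f (z + d) + (1 - d) / 2 * f (z + d) = Zop f z + (1 + d) / 2 * f z := by
  have hstep : (((z + d : GaussianInt) : ℂ) - z) = d := by
    rw [GaussianInt.toComplex_add, add_sub_cancel_left]
  have hint := integral_eq_add_of_norm_sub_eq_one hf (z := z) (w := z + d) (by rw [hstep, hd])
  rw [hstep] at hint
  simp only [Zop]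
  linear_combination hint

/-- The operator `Z` as a linear map on all functions on the lattice. -/
noncomputable def ZopLinear : (GaussianInt → ℂ) →ₗ[ℂ] GaussianInt → ℂ where
  toFun := Zop
  map_add' f g := by
    funext z
    simp only [Zop, integral, pathIntegral, Pi.add_apply]
    rw [add_add_add_comm, ← Finset.sum_add_distrib]
    congr 1
    · ring
    · exact Finset.sum_congr rfl fun k _ => by ring
  map_smul' c f := by
    funext z
    simp only [Zop, integral, pathIntegral, Pi.smul_apply, smul_eq_mul, RingHom.id_apply,
      mul_add, Finset.mul_sum]
    congr 1
    · ring
    · exact Finset.sum_congr rfl fun k _ => by ring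

noncomputable instance instAlgebraDAPoly : Algebra ℂ DAPoly :=
  Algebra.ofModule
    (fun c f g => toPolynomial.injective (by
      rw [toPolynomial_mul, map_smul, map_smul, toPolynomial_mul, smul_mul_assoc]))
    (fun c f g => toPolynomial.injective (by
      rw [toPolynomial_mul, map_smul, map_smul, toPolynomial_mul, mul_smul_comm]))

/-- The isomorphism `z^{(n)} ↦ Xⁿ` from the ring of discrete analytic polynomials with the product
`⊙` onto the ring of polynomials in one variable. -/
noncomputable def toPolynomialAlgEquiv : DAPoly ≃ₐ[ℂ] Polynomial ℂ :=
  AlgEquiv.ofLinearEquiv toPolynomial toPolynomial_one toPolynomial_mul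

instance instIsDomainDAPoly : IsDomain DAPoly :=
  toPolynomialAlgEquiv.toMulEquiv.isDomain _

theorem toPolynomialAlgEquiv_zpowDA (n : ℕ) :
    toPolynomialAlgEquiv (zpowDA n) = Polynomial.X ^ n :=
  toPolynomial_zpowDA n

theorem zpowDA_add (m n : ℕ) : zpowDA (m + n) = zpowDA m * zpowDA n :=
  toPolynomialAlgEquiv.injective (by simp only [map_mul, toPolynomialAlgEquiv_zpowDA, pow_add])

theorem zBasis_apply (n : ℕ) : zBasis n = zpowDA n := by
  rw [zBasis, Module.Basis.mk_apply]

theorem coe_zpowDA_one_mul (f : DAPoly) :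
    ((zpowDA 1 * f : DAPoly) : GaussianInt → ℂ) = Zop f := by
  have hlinear : DAPoly.subtype ∘ₗ LinearMap.mulLeft ℂ (zpowDA 1) =
      ZopLinear ∘ₗ DAPoly.subtype := by
    refine zBasis.ext fun n => ?_
    change ((zpowDA 1 * zBasis n : DAPoly) : GaussianInt → ℂ) = Zop (zBasis n : DAPoly)
    rw [zBasis_apply, ← zpowDA_add, add_comm]
    exact zpow_succ n
  exact LinearMap.congr_fun hlinear f

theorem linearDA_eq (c : ℂ) : linearDA c = zpowDA 1 + c • (1 : DAPoly) := by
  refine Subtype.ext (funext fun z => ?_)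
  change (z : ℂ) + c = zpow 1 z + c * 1
  rw [zpow_one, mul_one]

theorem linearDA_zero : linearDA 0 = zpowDA 1 := by
  rw [linearDA_eq, zero_smul, add_zero]

theorem linearDA_mul_apply (c : ℂ) (f : DAPoly) (z : GaussianInt) :
    ((linearDA c * f : DAPoly) : GaussianInt → ℂ) z =
      Zop f z + c * (f : GaussianInt → ℂ) z := by
  rw [linearDA_eq, add_mul, smul_mul_assoc, one_mul, ← coe_zpowDA_one_mul]
  rfl

theorem toPolynomialAlgEquiv_linearDA (c : ℂ) :
    toPolynomialAlgEquiv (linearDA c) = Polynomial.X - Polynomial.C (-c) := by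
  simp [linearDA_eq, toPolynomialAlgEquiv_zpowDA, Polynomial.smul_eq_C_mul]

theorem exists_eq_linearDA_mul_add_smul_one (c : ℂ) (f : DAPoly) :
    ∃ (q : DAPoly) (r : ℂ), f = linearDA c * q + r • (1 : DAPoly) := by
  set p := toPolynomialAlgEquiv f
  refine ⟨toPolynomialAlgEquiv.symm (p /ₘ (Polynomial.X - Polynomial.C (-c))), p.eval (-c),
    toPolynomialAlgEquiv.injective ?_⟩
  rw [map_add, map_mul, map_smul, map_one, toPolynomialAlgEquiv_linearDA, AlgEquiv.apply_symm_apply,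
    Polynomial.smul_eq_C_mul, mul_one, ← Polynomial.modByMonic_X_sub_C_eq_C_eval, add_comm,
    Polynomial.modByMonic_add_div]

theorem linearDA_ne_zero (c : ℂ) : linearDA c ≠ 0 := by
  rw [← map_ne_zero_iff toPolynomialAlgEquiv toPolynomialAlgEquiv.injective,
    toPolynomialAlgEquiv_linearDA]
  exact Polynomial.X_sub_C_ne_zero (-c)

/-- The linear polynomial `z + (1 - d) / 2` attached to a lattice direction `d`: the `⊙`-product
with it is inverse to the difference quotient in the direction `d`. -/
noncomputable def stepFactor (d : GaussianInt) : DAPoly := linearDA ((1 - d) / 2)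

theorem stepFactor_one : stepFactor 1 = zpowDA 1 := by
  rw [stepFactor, GaussianInt.toComplex_one, sub_self, zero_div, linearDA_zero]

theorem stepFactor_mul_apply_add {d : GaussianInt} (hd : ‖(d : ℂ)‖ = 1) (f : DAPoly)
    (z : GaussianInt) :
    ((stepFactor d * f : DAPoly) : GaussianInt → ℂ) (z + d) =
      ((stepFactor d * f : DAPoly) : GaussianInt → ℂ) z + d * (f : GaussianInt → ℂ) z := by
  rw [stepFactor, linearDA_mul_apply, linearDA_mul_apply]
  linear_combination Zop_add_of_norm_eq_one f.2.1 hd z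

theorem stepFactor_dvd_of_apply_eq_zero {d : GaussianInt} (hd : ‖(d : ℂ)‖ = 1) {f : DAPoly}
    (hf₀ : (f : GaussianInt → ℂ) 0 = 0) (hfd : (f : GaussianInt → ℂ) d = 0) :
    stepFactor d ∣ f := by
  obtain ⟨q, r, rfl⟩ := exists_eq_linearDA_mul_add_smul_one ((1 - d) / 2) f
  change ((stepFactor d * q : DAPoly) : GaussianInt → ℂ) 0 + r * 1 = 0 at hf₀
  change ((stepFactor d * q : DAPoly) : GaussianInt → ℂ) d + r * 1 = 0 at hfd
  have hq : (q : GaussianInt → ℂ) 0 = 0 := by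
    have hstep := stepFactor_mul_apply_add hd q 0
    rw [zero_add] at hstep
    have hd₀ : (d : ℂ) ≠ 0 := norm_ne_zero_iff.1 (by rw [hd]; exact one_ne_zero)
    refine (mul_eq_zero.1 ?_).resolve_left hd₀
    linear_combination hfd - hf₀ - hstep
  have hr : r = 0 := by
    rw [stepFactor, linearDA_mul_apply, Zop_zero, hq] at hf₀
    linear_combination hf₀
  rw [hr, zero_smul, add_zero]
  exact dvd_mul_right _ q

theorem zpowDA_one_mul_apply_zero (f : DAPoly) :
    ((zpowDA 1 * f : DAPoly) : GaussianInt → ℂ) 0 = 0 := by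
  rw [coe_zpowDA_one_mul, Zop_zero]

theorem zpowDA_one_dvd_iff (f : DAPoly) : zpowDA 1 ∣ f ↔ (f : GaussianInt → ℂ) 0 = 0 := by
  refine ⟨?_, fun hf => ?_⟩
  · rintro ⟨q, rfl⟩
    exact zpowDA_one_mul_apply_zero q
  · obtain ⟨q, r, rfl⟩ := exists_eq_linearDA_mul_add_smul_one 0 f
    rw [linearDA_zero] at hf ⊢
    change ((zpowDA 1 * q : DAPoly) : GaussianInt → ℂ) 0 + r * 1 = 0 at hf
    rw [zpowDA_one_mul_apply_zero, zero_add, mul_one] at hf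
    rw [hf, zero_smul, add_zero]
    exact dvd_mul_right _ q

theorem forall_le_eq_zero_iff_of_succ_eq_add_mul {R : Type*} [Ring R] [NoZeroDivisors R]
    {u v : ℕ → R} {c : R} (hc : c ≠ 0) (hstep : ∀ k, u (k + 1) = u k + c * v k) (n : ℕ) :
    (∀ k ≤ n, u k = 0) ↔ u 0 = 0 ∧ ∀ k < n, v k = 0 := by
  refine ⟨fun hu => ⟨hu 0 n.zero_le, fun k hk => ?_⟩, fun ⟨hu₀, hv⟩ k hk => ?_⟩
  · have h := hstep k
    rw [hu k hk.le, hu (k + 1) hk, zero_add] at h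
    exact (mul_eq_zero.1 h.symm).resolve_left hc
  · induction k with
    | zero => exact hu₀
    | succ k ih => rw [hstep, ih (by omega), hv k hk, mul_zero, add_zero]

theorem stepFactor_mul_vanishes_segment_iff {d : GaussianInt} (hd : ‖(d : ℂ)‖ = 1) (f : DAPoly)
    (z : GaussianInt) (n : ℕ) :
    (∀ k : ℕ, k ≤ n → ((stepFactor d * f : DAPoly) : GaussianInt → ℂ) (z + k * d) = 0) ↔
      ((stepFactor d * f : DAPoly) : GaussianInt → ℂ) z = 0 ∧
        ∀ k : ℕ, k < n → (f : GaussianInt → ℂ) (z + k * d) = 0 := by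
  have hd₀ : (d : ℂ) ≠ 0 := norm_ne_zero_iff.1 (by rw [hd]; exact one_ne_zero)
  have h := forall_le_eq_zero_iff_of_succ_eq_add_mul hd₀
    (u := fun k : ℕ => ((stepFactor d * f : DAPoly) : GaussianInt → ℂ) (z + k * d))
    (v := fun k : ℕ => (f : GaussianInt → ℂ) (z + k * d))
    (fun k => by
      rw [← stepFactor_mul_apply_add hd, Nat.cast_succ, add_mul, one_mul, add_assoc]) n
  simpa only [Nat.cast_zero, zero_mul, add_zero] using h

theorem vanishes_row_iff_zpowDA_dvd (a : ℕ) (f : DAPoly) :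
    (∀ j : ℕ, j < a → (f : GaussianInt → ℂ) j = 0) ↔ zpowDA a ∣ f := by
  induction a generalizing f with
  | zero => exact iff_of_true (fun j hj => absurd hj j.not_lt_zero) (one_dvd f)
  | succ a ih =>
    have hsucc : zpowDA (a + 1) = zpowDA 1 * zpowDA a := by rw [add_comm, zpowDA_add]
    by_cases hf : zpowDA 1 ∣ f
    · obtain ⟨q, rfl⟩ := hf
      have hsegment := stepFactor_mul_vanishes_segment_iff (d := 1) (by simp) q 0 a
      rw [stepFactor_one] at hsegment
      simp only [zero_add, mul_one, zpowDA_one_mul_apply_zero, true_and] at hsegment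
      rw [hsucc, mul_dvd_mul_iff_left (linearDA_zero ▸ linearDA_ne_zero 0), ← ih q, ← hsegment]
      simp only [Nat.lt_succ_iff]
    · refine iff_of_false (fun h => hf ?_) fun h => hf ?_
      · exact (zpowDA_one_dvd_iff f).2 (by simpa using h 0 a.succ_pos)
      · exact (Dvd.intro _ hsucc.symm).trans h

/-- The lattice points `j + k d` with `j < a` and `k ≤ b`. For `d = ± i` this is a rectangle with
`a` columns and `b + 1` rows. -/
def grid (d : GaussianInt) (a b : ℕ) : Set GaussianInt :=
  {z | ∃ j k : ℕ, j < a ∧ k ≤ b ∧ z = j + k * d}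

theorem forall_mem_grid {d : GaussianInt} {a b : ℕ} {P : GaussianInt → Prop} :
    (∀ z ∈ grid d a b, P z) ↔ ∀ j : ℕ, j < a → ∀ k : ℕ, k ≤ b → P (j + k * d) := by
  refine ⟨fun h j hj k hk => h _ ⟨j, k, hj, hk, rfl⟩, ?_⟩
  rintro h _ ⟨j, k, hj, hk, rfl⟩
  exact h j hj k hk

theorem stepFactor_mul_vanishes_grid_succ_iff {d : GaussianInt} (hd : ‖(d : ℂ)‖ = 1) (a b : ℕ)
    (f : DAPoly) :
    (∀ z ∈ grid d a (b + 1), ((stepFactor d * f : DAPoly) : GaussianInt → ℂ) z = 0) ↔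
      zpowDA a ∣ stepFactor d * f ∧ ∀ z ∈ grid d a b, (f : GaussianInt → ℂ) z = 0 := by
  simp only [forall_mem_grid, ← vanishes_row_iff_zpowDA_dvd,
    stepFactor_mul_vanishes_segment_iff hd, forall_and, Nat.lt_succ_iff]

theorem vanishes_grid_iff_dvd {d : GaussianInt} (hd : ‖(d : ℂ)‖ = 1) {a : ℕ} (ha : 0 < a)
    (b : ℕ) (f : DAPoly) :
    (∀ z ∈ grid d a b, (f : GaussianInt → ℂ) z = 0) ↔ zpowDA a * stepFactor d ^ b ∣ f := by
  induction b generalizing f with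
  | zero => simp [forall_mem_grid, vanishes_row_iff_zpowDA_dvd]
  | succ b ih =>
    have hsucc : zpowDA a * stepFactor d ^ (b + 1) =
        stepFactor d * (zpowDA a * stepFactor d ^ b) := by ring
    by_cases hf : stepFactor d ∣ f
    · obtain ⟨q, rfl⟩ := hf
      rw [stepFactor_mul_vanishes_grid_succ_iff hd, ih, hsucc,
        mul_dvd_mul_iff_left (show stepFactor d ≠ 0 from linearDA_ne_zero _)]
      exact and_iff_right_of_imp fun h => ((dvd_mul_right _ _).trans h).mul_left _
    · refine iff_of_false (fun h => hf ?_) fun h => hf ?_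
      · rw [forall_mem_grid] at h
        exact stepFactor_dvd_of_apply_eq_zero hd (by simpa using h 0 ha 0 (by omega))
          (by simpa using h 0 ha 1 (by omega))
      · exact (Dvd.intro _ hsucc.symm).trans h

/-- The vertical direction `± i` in which `R_λ` extends from the real axis. -/
def imDirection (l : GaussianInt) : GaussianInt := if 0 ≤ l.im then iL else -iL

theorem norm_imDirection (l : GaussianInt) : ‖(imDirection l : ℂ)‖ = 1 := by
  rw [imDirection]
  split_ifs <;> simp [iL, GaussianInt.toComplex_def]

theorem linearDA_alphaMP (l : GaussianInt) : linearDA (alphaMP l) = stepFactor (imDirection l) := by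
  rw [stepFactor, imDirection, alphaMP]
  split_ifs <;> simp [alphaMinus, alphaPlus, iL, GaussianInt.toComplex_def]

theorem rectangle_eq_grid {l : GaussianInt} (hl : l ∈ halfLattice) :
    rectangle l = grid (imDirection l) (l.re.toNat + 1) l.im.natAbs := by
  have hre : 0 ≤ l.re := hl
  ext ⟨x, y⟩
  have hgrid : ∀ e : ℤ, (⟨x, y⟩ : GaussianInt) ∈ grid ⟨0, e⟩ (l.re.toNat + 1) l.im.natAbs ↔
      ∃ j k : ℕ, j < l.re.toNat + 1 ∧ k ≤ l.im.natAbs ∧ x = j ∧ y = k * e := by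
    simp [grid, Zsqrtd.ext_iff]
  have hrectangle : (⟨x, y⟩ : GaussianInt) ∈ rectangle l ↔
      0 ≤ x ∧ x ≤ l.re ∧ y.natAbs ≤ l.im.natAbs ∧ 0 ≤ y * l.im := by
    rw [← Nat.cast_le (α := ℤ), Int.natCast_natAbs, Int.natCast_natAbs]
    exact Iff.rfl
  rw [hrectangle, imDirection]
  split_ifs with him
  · rw [show iL = ⟨0, 1⟩ from rfl, hgrid]
    refine ⟨fun ⟨_, _, _, hy⟩ => ⟨x.toNat, y.toNat, ?_⟩, ?_⟩
    · have hy₀ : 0 ≤ y := by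
        rcases him.eq_or_lt with him₀ | hpos
        · omega
        · exact nonneg_of_mul_nonneg_left hy hpos
      omega
    · rintro ⟨j, k, hj, hk, rfl, rfl⟩
      refine ⟨by omega, by omega, by omega, by positivity⟩
  · rw [show -iL = ⟨0, -1⟩ from rfl, hgrid]
    refine ⟨fun ⟨_, _, _, hy⟩ => ⟨x.toNat, y.natAbs, ?_⟩, ?_⟩
    · have hy₀ : y ≤ 0 := nonpos_of_mul_nonneg_left hy (not_le.1 him)
      omega
    · rintro ⟨j, k, hj, hk, rfl, rfl⟩
      refine ⟨by omega, by omega, by omega, by nlinarith⟩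

theorem vanishes_rectangle_iff_generator_dvd {l : GaussianInt} (hl : l ∈ halfLattice)
    (f : DAPoly) :
    (∀ z ∈ rectangle l, (f : GaussianInt → ℂ) z = 0) ↔ generator l ∣ f := by
  rw [generator, linearDA_alphaMP, rectangle_eq_grid hl,
    vanishes_grid_iff_dvd (norm_imDirection l) (Nat.succ_pos _)]

theorem apply_eq_sum_repr (f : DAPoly) (z : GaussianInt) :
    (f : GaussianInt → ℂ) z = ∑ n ∈ (zBasis.repr f).support, zBasis.repr f n * zpow n z := by
  conv_lhs => rw [← zBasis.linearCombination_repr f]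
  rw [Finsupp.linearCombination_apply, Finsupp.sum, AddSubmonoidClass.coe_finsetSum,
    Finset.sum_apply]
  refine Finset.sum_congr rfl fun n _ => ?_
  rw [zBasis_apply]
  rfl

theorem memHardy_coe (f : DAPoly) : MemHardy (f : GaussianInt → ℂ) := by
  refine ⟨zBasis.repr f, summable_of_ne_finset_zero (s := (zBasis.repr f).support) ?_,
    fun z _ => ?_⟩
  · intro n hn
    simp [Finsupp.notMem_support_iff.1 hn]
  · rw [apply_eq_sum_repr f z]
    refine hasSum_sum_of_ne_finset_zero fun n hn => ?_
    rw [Finsupp.notMem_support_iff.1 hn, zero_mul]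

end DiscreteAnalytic

theorem mainTheorem7 (l : GaussianInt) (hl : l ∈ DiscreteAnalytic.halfLattice) :
    (∀ p : DiscreteAnalytic.DAPoly,
      (∀ z ∈ DiscreteAnalytic.rectangle l, (p : GaussianInt → ℂ) z = 0) ↔
        ∃ q : DiscreteAnalytic.DAPoly, p = DiscreteAnalytic.generator l * q) ∧
    ∃ I : Ideal DiscreteAnalytic.DAPoly,
      (I : Set DiscreteAnalytic.DAPoly) =
        {p : DiscreteAnalytic.DAPoly | DiscreteAnalytic.IsSolution l (p : GaussianInt → ℂ)} ∧
      I = Ideal.span {DiscreteAnalytic.generator l} := by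
  have vanishes_iff_dvd := DiscreteAnalytic.vanishes_rectangle_iff_generator_dvd hl
  refine ⟨vanishes_iff_dvd, Ideal.span {DiscreteAnalytic.generator l}, ?_, rfl⟩
  ext p
  rw [SetLike.mem_coe, Ideal.mem_span_singleton, ← vanishes_iff_dvd p]
  exact (and_iff_right (DiscreteAnalytic.memHardy_coe p)).symm
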